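/- For each $n\in\mathbb N$ let $\mathcal H_n$ be a separable complex Hilbert space and let $\varrho_n,\sigma_n$ be non-zero positive semi-definite bounded operators on $\mathcal H_n$ (not necessarily trace-class, and with no relation assumed between different $n$); write $\vec\varrho=(\varrho_n)_n$, $\vec\sigma=(\sigma_n)_n$. All traces of positive semi-definite operators take values in $[0,+\infty]$, all logarithms, limits, suprema and infima take values in $[-\infty,+\infty]$, $\log 0=-\infty$, $\log(+\infty)=+\infty$. **Divergences.** For non-zero positive semi-definite bounded operators $\varrho,\sigma$ on $\mathcal H$ and $\alpha>1$: if there is a bounded $R$ with $\varrho=\sigma^{\frac{\alpha-1}{2\alpha}}R\,\sigma^{\frac{\alpha-1}{2\alpha}}$, let $\varrho_{\sigma,\alpha}$ be the unique positive semi-definite such $R$ whose support is contained in the support of $\sigma$, and put $Q^*_\alpha(\varrho\|\sigma):=\operatorname{Tr}(\varrho_{\sigma,\alpha})^{\alpha}$; otherwise put $Q^*_\alpha(\varrho\|\sigma):=+\infty$. Let $\psi^*(\varrho\|\sigma|\alpha):=\log Q^*_\alpha(\varrho\|\sigma)$, $D_{\max}(\varrho\|\sigma):=\inf\{\kappa\in\mathbb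 R:\varrho\le e^{\kappa}\sigma\}$, and for $u\in[0,1]$ $$\tilde\psi^*(\varrho\|\sigma|u):=\begin{cases}\log\operatorname{Tr}\varrho,&u=0,\\(1-u)\,\psi^*\!\left(\varrho\|\sigma\big|\tfrac1{1-u}\right),&0<u<1,\\D_{\max}(\varrho\|\sigma),&u=1.\end{cases}$$ Set $\tilde\psi^*(\vec\varrho\|\vec\sigma|u):=\limsup_{n\to\infty}\frac1n\tilde\psi^*(\varrho_n\|\sigma_n|u)$ and, for $r\in\mathbb R$, define the generalized Hoeffding anti-divergence $$\hat H^*_r(\vec\varrho\|\vec\sigma):=\sup_{u\in[0,1]}\left\{ur-\tilde\psi^*(\vec\varrho\|\vec\sigma|u)\right\}.$$ **Strong converse exponents.** A test sequence is a sequence of operators $T_n$ on $\mathcal H_n$ with $0\le T_n\le I$. Put $\gamma_n(T_n|\varrho_n):=\operatorname{Tr}(T_n^{1/2}\varrho_nT_n^{1/2})$ and $\beta_n(T_n|\sigma_n):=\operatorname{Tr}(T_n^{1/2}\sigma_nT_n^{1/2})$. For $r\in\mathbb R$ let $\underline{\mathrm{sc}}_r(\vec\varrho\|\vec\sigma)$,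 $\overline{\mathrm{sc}}_r(\vec\varrho\|\vec\sigma)$ and $\mathrm{sc}_r(\vec\varrho\|\vec\sigma)$ be the infima of, respectively, $$\liminf_{n\to\infty}-\tfrac1n\log\gamma_n(T_n|\varrho_n),\qquad \limsup_{n\to\infty}-\tfrac1n\log\gamma_n(T_n|\varrho_n),\qquad \lim_{n\to\infty}-\tfrac1n\log\gamma_n(T_n|\varrho_n)$$ over all test sequences with $\liminf_{n\to\infty}-\frac1n\log\beta_n(T_n|\sigma_n)\ge r$, where in the last case only test sequences for which the limit exists in $[-\infty,+\infty]$ are admitted. **Proposition.** For every $r\in\mathbb R$, $$\hat H^*_r(\vec\varrho\|\vec\sigma)\ \le\ \underline{\mathrm{sc}}_r(\vec\varrho\|\vec\sigma)\ \le\ \overline{\mathrm{sc}}_r(\vec\varrho\|\vec\sigma)\ \le\ \mathrm{sc}_r(\vec\varrho\|\vec\sigma).$$ -/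

import Mathlib

open scoped InnerProductSpace ENNReal

noncomputable section

namespace OpDiscr

section SingleSpace

variable {H : Type*} [NormedAddCommGroup H] [InnerProductSpace ℂ H] [CompleteSpace H]

/-- The (possibly infinite) trace `∑ᵢ ⟪bᵢ, A bᵢ⟫` of a positive semi-definite bounded operator,
computed in some Hilbert basis `b`. By `opTrace_eq` the choice of the basis is irrelevant. -/
def opTrace (A : H →L[ℂ] H) : ℝ≥0∞ :=
  ∑' i, ENNReal.ofReal
    (RCLike.re ⟪(exists_hilbertBasis ℂ H).choose_spec.choose i,
      A ((exists_hilbertBasis ℂ H).choose_spec.choose i)⟫_ℂ)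

theorem ofReal_norm_sq_eq_tsum {ι : Type*} (b : HilbertBasis ι ℂ H) (x : H) :
    ENNReal.ofReal (‖x‖ ^ 2) = ∑' i, ENNReal.ofReal (‖⟪b i, x⟫_ℂ‖ ^ 2) := by
  have h := b.hasSum_inner_mul_inner x x
  have h2 : HasSum (fun i => ‖⟪b i, x⟫_ℂ‖ ^ 2) (‖x‖ ^ 2) := by
    have h3 := (Complex.hasSum_re h)
    convert h3 using 1
    · funext i
      rw [← inner_conj_symm x (b i), RCLike.conj_mul]
      norm_cast
    · rw [inner_self_eq_norm_sq_to_K]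
      norm_cast
  rw [← h2.tsum_eq, ENNReal.ofReal_tsum_of_nonneg (fun i => by positivity) h2.summable]

/-- The trace of a positive semi-definite operator does not depend on the Hilbert basis. -/
theorem opTrace_eq {ι : Type*} (b : HilbertBasis ι ℂ H) {A : H →L[ℂ] H} (hA : 0 ≤ A) :
    opTrace A = ∑' i, ENNReal.ofReal (RCLike.re ⟪b i, A (b i)⟫_ℂ) := by
  have hS : (CFC.sqrt A).IsPositive :=
    (ContinuousLinearMap.nonneg_iff_isPositive _).1 (CFC.sqrt_nonneg A)
  have key : ∀ x y : H, ⟪x, CFC.sqrt A y⟫_ℂ = ⟪CFC.sqrt A x, y⟫_ℂ :=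
    fun x y => (hS.inner_left_eq_inner_right x y).symm
  have hq : ∀ x : H, RCLike.re ⟪x, A x⟫_ℂ = ‖CFC.sqrt A x‖ ^ 2 := by
    intro x
    conv_lhs => rw [← CFC.sqrt_mul_sqrt_self A hA]
    rw [mul_apply_eq_comp, key]
    exact inner_self_eq_norm_sq _
  unfold opTrace
  simp only [hq]
  generalize (exists_hilbertBasis ℂ H).choose_spec.choose = c
  calc ∑' i, ENNReal.ofReal (‖CFC.sqrt A (c i)‖ ^ 2)
      = ∑' i, ∑' j, ENNReal.ofReal (‖⟪b j, CFC.sqrt A (c i)⟫_ℂ‖ ^ 2) := by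
        simp_rw [ofReal_norm_sq_eq_tsum b]
    _ = ∑' j, ∑' i, ENNReal.ofReal (‖⟪b j, CFC.sqrt A (c i)⟫_ℂ‖ ^ 2) := ENNReal.tsum_comm
    _ = ∑' j, ENNReal.ofReal (‖CFC.sqrt A (b j)‖ ^ 2) := by
        refine tsum_congr fun j => ?_
        rw [ofReal_norm_sq_eq_tsum c]
        refine tsum_congr fun i => ?_
        rw [key, ← inner_conj_symm, RCLike.norm_conj]

/-- The support of a (self-adjoint) operator: the orthogonal complement of its kernel. -/
def supp (A : H →L[ℂ] H) : Submodule ℂ H := (A.ker)ᗮ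

/-- `ρ ∈ 𝓑^{α,z}(H, σ)`: some bounded `R` satisfies
`ρ^(α/z) = σ^((α-1)/(2z)) R σ^((α-1)/(2z))`. -/
def MemB (α z : ℝ) (ρ σ : H →L[ℂ] H) : Prop :=
  ∃ R : H →L[ℂ] H, ρ ^ (α / z) = σ ^ ((α - 1) / (2 * z)) * R * σ ^ ((α - 1) / (2 * z))

/-- `R` is positive semi-definite, is supported in the support of `σ`, and satisfies
`ρ^(α/z) = σ^((α-1)/(2z)) R σ^((α-1)/(2z))`. -/
structure IsRenyiFactor (α z : ℝ) (ρ σ R : H →L[ℂ] H) : Prop where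
  nonneg : 0 ≤ R
  supp_le : supp R ≤ supp σ
  eq : ρ ^ (α / z) = σ ^ ((α - 1) / (2 * z)) * R * σ ^ ((α - 1) / (2 * z))

open Classical in
/-- The operator `ρ_{σ,α,z}`, which exists and is unique when `ρ ∈ 𝓑^{α,z}(H, σ)`; see
`isRenyiFactor_renyiFactor` and `IsRenyiFactor.unique`. -/
def renyiFactor (α z : ℝ) (ρ σ : H →L[ℂ] H) : H →L[ℂ] H :=
  if h : ∃ R, IsRenyiFactor α z ρ σ R then h.choose else 0

theorem rpow_apply_eq_zero {A : H →L[ℂ] H} (hA : 0 ≤ A) {t : ℝ} (ht : 0 < t) {x : H}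
    (hx : A x = 0) : (A ^ t) x = 0 := by
  have hsq : ∀ B : H →L[ℂ] H, 0 ≤ B → B x = 0 → CFC.sqrt B x = 0 := by
    intro B hB hBx
    have hS : (CFC.sqrt B).IsPositive :=
      (ContinuousLinearMap.nonneg_iff_isPositive _).1 (CFC.sqrt_nonneg B)
    have h1 : ⟪CFC.sqrt B x, CFC.sqrt B x⟫_ℂ = 0 := by
      rw [hS.inner_left_eq_inner_right, ← mul_apply_eq_comp,
        CFC.sqrt_mul_sqrt_self B hB, hBx, inner_zero_right]
    exact inner_self_eq_zero.1 h1
  have hdy : ∀ k : ℕ, (A ^ ((1 / 2 : ℝ) ^ k)) x = 0 := by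
    intro k
    induction k with
    | zero => rw [pow_zero, CFC.rpow_one A hA]; exact hx
    | succ k ih =>
      have h1 := hsq (A ^ ((1 / 2 : ℝ) ^ k)) CFC.rpow_nonneg ih
      have h2 : CFC.sqrt (A ^ ((1 / 2 : ℝ) ^ k)) = A ^ ((1 / 2 : ℝ) ^ (k + 1)) := by
        rw [CFC.sqrt_eq_rpow, CFC.rpow_rpow_of_exponent_nonneg A _ _ (by positivity)
          (by positivity) hA, pow_succ]
      rwa [h2] at h1
  obtain ⟨k, hk⟩ := exists_pow_lt_of_lt_one ht (by norm_num : (1 / 2 : ℝ) < 1)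
  have hadd : A ^ t = A ^ (t - (1 / 2 : ℝ) ^ k) * A ^ ((1 / 2 : ℝ) ^ k) := by
    obtain ⟨p, hp⟩ : ∃ p : NNReal, (p : ℝ) = (1 / 2 : ℝ) ^ k := ⟨⟨_, by positivity⟩, rfl⟩
    obtain ⟨q, hq⟩ : ∃ q : NNReal, (q : ℝ) = t - (1 / 2 : ℝ) ^ k :=
      ⟨⟨_, (sub_pos.2 hk).le⟩, rfl⟩
    have hp0 : 0 < p := by rw [← NNReal.coe_pos, hp]; positivity
    have hq0 : 0 < q := by rw [← NNReal.coe_pos, hq]; linarith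
    have h := CFC.nnrpow_add (a := A) hq0 hp0
    rw [CFC.nnrpow_eq_rpow hq0, CFC.nnrpow_eq_rpow hp0, CFC.nnrpow_eq_rpow (add_pos hq0 hp0),
      NNReal.coe_add, hp, hq, sub_add_cancel] at h
    exact h
  rw [hadd, mul_apply_eq_comp, hdy k, map_zero]

theorem ker_rpow {A : H →L[ℂ] H} (hA : 0 ≤ A) {t : ℝ} (ht : 0 < t) :
    (A ^ t).ker = A.ker := by
  ext x
  simp only [LinearMap.mem_ker, ContinuousLinearMap.coe_coe]
  refine ⟨fun h => ?_, rpow_apply_eq_zero hA ht⟩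
  have h1 := rpow_apply_eq_zero (A := A ^ t) CFC.rpow_nonneg (inv_pos.2 ht) h
  rwa [CFC.rpow_rpow_of_exponent_nonneg A _ _ ht.le (inv_nonneg.2 ht.le) hA,
    mul_inv_cancel₀ ht.ne', CFC.rpow_one A hA] at h1

theorem ker_eq_ker_of_supp_le {A B : H →L[ℂ] H} (h : supp A ≤ supp B) : B.ker ≤ A.ker := by
  have hA := A.isClosed_ker.completeSpace_coe
  have hB := B.isClosed_ker.completeSpace_coe
  have h1 := Submodule.orthogonal_le h
  unfold supp at h1
  rwa [Submodule.orthogonal_orthogonal, Submodule.orthogonal_orthogonal] at h1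

theorem closure_range_of_nonneg {S : H →L[ℂ] H} (hS : 0 ≤ S) :
    S.range.topologicalClosure = supp S := by
  have h : S.adjoint = S :=
    ((ContinuousLinearMap.nonneg_iff_isPositive _).1 hS).isSelfAdjoint
  rw [supp, ContinuousLinearMap.orthogonal_ker, h]

/-- There is at most one operator as in `IsRenyiFactor`. -/
theorem IsRenyiFactor.unique {α z : ℝ} (hα : 1 < α) (hz : 0 < z) {ρ σ R R' : H →L[ℂ] H}
    (hσ : 0 ≤ σ) (h : IsRenyiFactor α z ρ σ R) (h' : IsRenyiFactor α z ρ σ R') : R = R' := by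
  have ht : 0 < (α - 1) / (2 * z) := div_pos (by linarith) (by linarith)
  set S := σ ^ ((α - 1) / (2 * z)) with hSdef
  have hS : 0 ≤ S := CFC.rpow_nonneg
  have hSp := (ContinuousLinearMap.nonneg_iff_isPositive _).1 hS
  have hRp := (ContinuousLinearMap.nonneg_iff_isPositive _).1 h.nonneg
  have hRp' := (ContinuousLinearMap.nonneg_iff_isPositive _).1 h'.nonneg
  have hker : S.ker = σ.ker := ker_rpow hσ ht
  set D := R - R' with hD
  have hDk : ∀ x, S x = 0 → D x = 0 := by
    intro x hx
    have hx' : x ∈ σ.ker := hker ▸ (LinearMap.mem_ker.2 hx)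
    have h1 : R x = 0 := ker_eq_ker_of_supp_le h.supp_le hx'
    have h2 : R' x = 0 := ker_eq_ker_of_supp_le h'.supp_le hx'
    simp [hD, h1, h2]
  have hDsa : ∀ x y, ⟪D x, y⟫_ℂ = ⟪x, D y⟫_ℂ := by
    intro x y
    simp only [hD, sub_apply, inner_sub_left, inner_sub_right,
      hRp.inner_left_eq_inner_right, hRp'.inner_left_eq_inner_right]
  have hSDS : ∀ y, S (D (S y)) = 0 := by
    intro y
    have h1 : S * R * S = S * R' * S := h.eq.symm.trans h'.eq
    have h2 := congrArg (fun T : H →L[ℂ] H => T y) h1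
    simp only [mul_apply_eq_comp] at h2
    simp [hD, h2]
  have hDS : ∀ y, D (S y) = 0 := by
    intro y
    have h1 : D (D (S y)) = 0 := hDk _ (hSDS y)
    have h2 : ⟪D (S y), D (S y)⟫_ℂ = 0 := by rw [hDsa, h1, inner_zero_right]
    exact inner_self_eq_zero.1 h2
  have hSD : ∀ x, S (D x) = 0 := by
    intro x
    refine ext_inner_right ℂ fun y => ?_
    rw [hSp.inner_left_eq_inner_right, hDsa, hDS, inner_zero_right, inner_zero_left]
  have hDz : ∀ x, D x = 0 := by
    intro x
    have h1 : D (D x) = 0 := hDk _ (hSD x)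
    have h2 : ⟪D x, D x⟫_ℂ = 0 := by rw [hDsa, h1, inner_zero_right]
    exact inner_self_eq_zero.1 h2
  exact sub_eq_zero.1 (ContinuousLinearMap.ext hDz)

/-- If `ρ ∈ 𝓑^{α,z}(H, σ)` then `ρ_{σ,α,z}` has its defining properties. -/
theorem isRenyiFactor_renyiFactor {α z : ℝ} (hα : 1 < α) (hz : 0 < z) {ρ σ : H →L[ℂ] H}
    (hσ : 0 ≤ σ) (h : MemB α z ρ σ) : IsRenyiFactor α z ρ σ (renyiFactor α z ρ σ) := by
  suffices hex : ∃ R, IsRenyiFactor α z ρ σ R by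
    rw [renyiFactor, dif_pos hex]
    exact hex.choose_spec
  obtain ⟨R, hR⟩ := h
  have ht : 0 < (α - 1) / (2 * z) := div_pos (by linarith) (by linarith)
  set S := σ ^ ((α - 1) / (2 * z)) with hSdef
  have hS : 0 ≤ S := CFC.rpow_nonneg
  have hSp := (ContinuousLinearMap.nonneg_iff_isPositive _).1 hS
  have hker : S.ker = σ.ker := ker_rpow hσ ht
  have hρ : (ρ ^ (α / z)).IsPositive :=
    (ContinuousLinearMap.nonneg_iff_isPositive _).1 CFC.rpow_nonneg
  have hcomp : CompleteSpace (supp σ) := (Submodule.isClosed_orthogonal _).completeSpace_coe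
  set P := (supp σ).starProjection with hP
  have hPsa : ∀ x y, ⟪P x, y⟫_ℂ = ⟪x, P y⟫_ℂ := fun x y =>
    Submodule.inner_starProjection_left_eq_right _ x y
  have hPk : ∀ x, S x = 0 → P x = 0 := by
    intro x hx
    have hx' : x ∈ σ.ker := hker ▸ (LinearMap.mem_ker.2 hx)
    rw [hP, Submodule.starProjection_apply_eq_zero_iff]
    exact Submodule.le_orthogonal_orthogonal _ hx'
  have hran : S.range.topologicalClosure = supp σ := by
    rw [closure_range_of_nonneg hS, supp, supp, hker]
  have hPS : ∀ y, P (S y) = S y := by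
    intro y
    rw [hP, Submodule.starProjection_eq_self_iff, ← hran]
    exact Submodule.le_topologicalClosure _ ⟨y, rfl⟩
  have hSP : ∀ x, S (P x) = S x := by
    intro x
    refine ext_inner_right ℂ fun y => ?_
    rw [hSp.inner_left_eq_inner_right, hPsa, hPS, hSp.inner_left_eq_inner_right]
  have hpos : ∀ w ∈ closure (S.range : Set H),
      ((RCLike.re ⟪R w, w⟫_ℂ : ℝ) : ℂ) = ⟪R w, w⟫_ℂ ∧ 0 ≤ RCLike.re ⟪R w, w⟫_ℂ := by
    intro w hw
    have hcl : IsClosed {w : H | ((RCLike.re ⟪R w, w⟫_ℂ : ℝ) : ℂ) = ⟪R w, w⟫_ℂ ∧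
        0 ≤ RCLike.re ⟪R w, w⟫_ℂ} := by
      have hc : Continuous fun w : H => ⟪R w, w⟫_ℂ := by fun_prop
      have hre : Continuous fun w : H => RCLike.re ⟪R w, w⟫_ℂ := Complex.continuous_re.comp hc
      exact (isClosed_eq (Complex.continuous_ofReal.comp hre) hc).inter
        (isClosed_le continuous_const hre)
    refine closure_minimal ?_ hcl hw
    rintro _ ⟨y, rfl⟩
    have h1 : ⟪R (S y), S y⟫_ℂ = ⟪(ρ ^ (α / z)) y, y⟫_ℂ := by
      rw [hR, ← hSp.inner_left_eq_inner_right]; rfl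
    change ((RCLike.re ⟪R (S y), S y⟫_ℂ : ℝ) : ℂ) = ⟪R (S y), S y⟫_ℂ ∧
      0 ≤ RCLike.re ⟪R (S y), S y⟫_ℂ
    rw [h1]
    exact (ContinuousLinearMap.isPositive_iff_complex _).1 hρ y
  refine ⟨P * R * P, ?_, ?_, ?_⟩
  · rw [ContinuousLinearMap.nonneg_iff_isPositive, ContinuousLinearMap.isPositive_iff_complex]
    intro x
    have h1 : ⟪(P * R * P) x, x⟫_ℂ = ⟪R (P x), P x⟫_ℂ := by rw [← hPsa]; rfl
    have hm : P x ∈ closure (S.range : Set H) := by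
      have hm' : P x ∈ S.range.topologicalClosure := by
        rw [hran]
        exact Submodule.starProjection_apply_mem _ x
      exact hm'
    rw [h1]
    exact hpos (P x) hm
  · refine Submodule.orthogonal_le fun x hx => ?_
    have hx' : S x = 0 := LinearMap.mem_ker.1 (hker ▸ hx : x ∈ S.ker)
    change P (R (P x)) = 0
    rw [hPk x hx', map_zero, map_zero]
  · rw [hR]
    ext x
    have h1 : S (P (R (P (S x)))) = S (R (S x)) := by rw [hPS, hSP]
    exact h1.symm

/-- `Q_{α,z}(ρ‖σ) = Tr (ρ_{σ,α,z})^z` if `ρ ∈ 𝓑^{α,z}(H, σ)`, and `+∞` otherwise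
(for `α > 1`, `z > 0`). -/
def renyiQ (α z : ℝ) (ρ σ : H →L[ℂ] H) : ℝ≥0∞ :=
  open Classical in if MemB α z ρ σ then opTrace (renyiFactor α z ρ σ ^ z) else ⊤

/-- `ψ*(ρ‖σ|α) = log Q*_α(ρ‖σ)`, where `Q*_α = Q_{α,α}` (for `α > 1`). -/
def psiStar (ρ σ : H →L[ℂ] H) (α : ℝ) : EReal := ENNReal.log (renyiQ α α ρ σ)

/-- The max-relative entropy `inf {κ ∈ ℝ : ρ ≤ exp(κ) σ}`. -/
def Dmax (ρ σ : H →L[ℂ] H) : EReal :=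
  ⨅ (κ : ℝ) (_ : ρ ≤ Real.exp κ • σ), (κ : EReal)

/-- `ψ̃*(ρ‖σ|u)` for `u ∈ [0,1]`; the value is only meaningful for these `u`. -/
def psiTilde (ρ σ : H →L[ℂ] H) (u : ℝ) : EReal :=
  if u = 0 then ENNReal.log (opTrace ρ)
  else if u = 1 then Dmax ρ σ
  else ((1 - u : ℝ) : EReal) * psiStar ρ σ (1 - u)⁻¹

/-- `T` is a test: `0 ≤ T ≤ I`. -/
def IsTest (T : H →L[ℂ] H) : Prop := 0 ≤ T ∧ T ≤ 1

/-- `Tr (T^{1/2} A T^{1/2})`. With `A = ρ` it is the generalized type I success `γ(T|ρ)`, with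
`A = σ` the generalized type II error `β(T|σ)`. -/
def testTrace (T A : H →L[ℂ] H) : ℝ≥0∞ := opTrace (CFC.sqrt T * A * CFC.sqrt T)

end SingleSpace

section Sequences

variable {H : ℕ → Type*} [∀ n, NormedAddCommGroup (H n)] [∀ n, InnerProductSpace ℂ (H n)]
  [∀ n, CompleteSpace (H n)]

/-- The sequence `-(1/n) log Tr (Tₙ^{1/2} Aₙ Tₙ^{1/2})`. -/
def rate (T A : ∀ n, H n →L[ℂ] H n) (n : ℕ) : EReal :=
  -(((1 / (n : ℝ) : ℝ) : EReal) * ENNReal.log (testTrace (T n) (A n)))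

/-- The test sequences with type II exponent at least `r`:
`liminf -(1/n) log β(Tₙ|σₙ) ≥ r`. -/
def IsAdmissible (σ : ∀ n, H n →L[ℂ] H n) (r : ℝ) (T : ∀ n, H n →L[ℂ] H n) : Prop :=
  (∀ n, IsTest (T n)) ∧ (r : EReal) ≤ Filter.liminf (rate T σ) Filter.atTop

/-- The lower strong converse exponent. -/
def scLower (ρ σ : ∀ n, H n →L[ℂ] H n) (r : ℝ) : EReal :=
  sInf {x | ∃ T, IsAdmissible σ r T ∧ x = Filter.liminf (rate T ρ) Filter.atTop}

/-- The upper strong converse exponent. -/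
def scUpper (ρ σ : ∀ n, H n →L[ℂ] H n) (r : ℝ) : EReal :=
  sInf {x | ∃ T, IsAdmissible σ r T ∧ x = Filter.limsup (rate T ρ) Filter.atTop}

/-- The strong converse exponent over the test sequences for which the limit exists (in
`[-∞, +∞]`). -/
def sc (ρ σ : ∀ n, H n →L[ℂ] H n) (r : ℝ) : EReal :=
  sInf {x | ∃ T, IsAdmissible σ r T ∧ Filter.Tendsto (rate T ρ) Filter.atTop (nhds x)}

/-- `ψ̃*` of the sequences: `limsup (1/n) ψ̃*(ρₙ‖σₙ|u)`. -/
def psiTildeSeq (ρ σ : ∀ n, H n →L[ℂ] H n) (u : ℝ) : EReal :=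
  Filter.limsup (fun n : ℕ => ((1 / (n : ℝ) : ℝ) : EReal) * psiTilde (ρ n) (σ n) u) Filter.atTop

/-- The generalized Hoeffding anti-divergence
`sup {u r - ψ̃*(ρ⃗‖σ⃗|u) : u ∈ [0,1]}`. -/
def hoeffdingAnti (ρ σ : ∀ n, H n →L[ℂ] H n) (r : ℝ) : EReal :=
  ⨆ u ∈ Set.Icc (0 : ℝ) 1, ((u * r : ℝ) : EReal) - psiTildeSeq ρ σ u

end Sequences

end OpDiscr

end

namespace OpDiscr

section SingleSpace

variable {H : Type*} [NormedAddCommGroup H] [InnerProductSpace ℂ H] [CompleteSpace H]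

/-! The first inequality is a one-shot bound followed by a limit; the other two compare infima
directly. For a test `T` and `0 < u < 1` put `α = 1 / (1 - u)`. Then `γ ≤ Q*_α ^ (1 - u) * β ^ u`,
that is, `log γ ≤ ψ̃*(u) + u * log β`. The endpoints are `γ ≤ Tr ρ` and `γ ≤ exp κ * β`. Dividing by
`n` and passing to the limit gives the Hoeffding bound for each `u`.

The one-shot bound (`opTrace_conj_le`) is reduced to scalar sums, which handles traces that may be
infinite. Write `ρ = S R S` and `A = T^{1/2}`. On the span of finitely many basis vectors,
diagonalize the compression of `A S² A` by `f j`. The vectors `S A f j` are then orthogonal, the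
partial trace is a finite sum of products, and the scalar Hölder inequality applies. Jensen's
inequality for quadratic forms (`re_inner_rpow_le`) bounds the two factors by traces of `R ^ α` and
`A σ A`. -/

omit [CompleteSpace H] in
theorem re_inner_mono {A B : H →L[ℂ] H} (h : A ≤ B) (x : H) :
    RCLike.re ⟪x, A x⟫_ℂ ≤ RCLike.re ⟪x, B x⟫_ℂ := by
  have h1 := ((ContinuousLinearMap.le_def A B).1 h).re_inner_nonneg_right x
  rw [sub_apply, inner_sub_right, map_sub] at h1
  linarith

omit [CompleteSpace H] in
theorem re_inner_nonneg {A : H →L[ℂ] H} (hA : 0 ≤ A) (x : H) : 0 ≤ RCLike.re ⟪x, A x⟫_ℂ :=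
  ((ContinuousLinearMap.nonneg_iff_isPositive _).1 hA).re_inner_nonneg_right x

omit [CompleteSpace H] in
theorem inner_apply_comm {A : H →L[ℂ] H} (hA : 0 ≤ A) (x y : H) : ⟪x, A y⟫_ℂ = ⟪A x, y⟫_ℂ :=
  (((ContinuousLinearMap.nonneg_iff_isPositive _).1 hA).inner_left_eq_inner_right x y).symm

theorem re_inner_eq_norm_sqrt_sq {A : H →L[ℂ] H} (hA : 0 ≤ A) (x : H) :
    RCLike.re ⟪x, A x⟫_ℂ = ‖CFC.sqrt A x‖ ^ 2 := by
  conv_lhs => rw [← CFC.sqrt_mul_sqrt_self A hA]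
  rw [mul_apply_eq_comp, inner_apply_comm (CFC.sqrt_nonneg A)]
  exact inner_self_eq_norm_sq _

theorem norm_sqrt_apply_le {T : H →L[ℂ] H} (hT : IsTest T) (x : H) :
    ‖CFC.sqrt T x‖ ≤ ‖x‖ := by
  have h := re_inner_mono hT.2 x
  rw [re_inner_eq_norm_sqrt_sq hT.1, one_apply_eq_self, inner_self_eq_norm_sq] at h
  exact le_of_sq_le_sq h (norm_nonneg x)

/-! ### Jensen's inequality for quadratic forms -/

/-- The convex function `t ^ s` lies above its tangent at `a`; Young's inequality gives this also at
`a = 0`. -/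
theorem mul_rpow_sub_one_le {s a t : ℝ} (hs : 1 < s) (ha : 0 ≤ a) (ht : 0 ≤ t) :
    s * a ^ (s - 1) * t ≤ t ^ s + (s - 1) * a ^ s := by
  have hpq : s.HolderConjugate (s / (s - 1)) := Real.HolderConjugate.conjExponent hs
  have h := Real.young_inequality_of_nonneg ht (Real.rpow_nonneg ha (s - 1)) hpq
  rw [← Real.rpow_mul ha, mul_div_cancel₀ _ (sub_pos.2 hs).ne'] at h
  have hs0 : 0 < s := by linarith
  have hs1 : 0 < s - 1 := by linarith
  have h2 := mul_le_mul_of_nonneg_left h hs0.le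
  field_simp at h2
  linarith

/-- Jensen's inequality for the vector functional of a subunit vector. -/
theorem re_inner_rpow_le {M : H →L[ℂ] H} (hM : 0 ≤ M) {s : ℝ} (hs : 1 < s) {x : H}
    (hx : ‖x‖ ≤ 1) : RCLike.re ⟪x, M x⟫_ℂ ^ s ≤ RCLike.re ⟪x, (M ^ s) x⟫_ℂ := by
  obtain ⟨a, ha⟩ : ∃ a : NNReal, (a : ℝ) = RCLike.re ⟪x, M x⟫_ℂ :=
    ⟨⟨_, re_inner_nonneg hM x⟩, rfl⟩
  obtain ⟨c, hc⟩ : ∃ c : NNReal, (c : ℝ) = s * (a : ℝ) ^ (s - 1) := ⟨⟨_, by positivity⟩, rfl⟩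
  obtain ⟨d, hd⟩ : ∃ d : NNReal, (d : ℝ) = (s - 1) * (a : ℝ) ^ s :=
    ⟨⟨_, mul_nonneg (by linarith) (by positivity)⟩, rfl⟩
  have hcont : Continuous fun t : NNReal => t ^ s := NNReal.continuous_rpow_const (by linarith)
  -- The tangent is taken at `a = ⟪x, M x⟫`. Its negative constant is moved to the right as `d`, so
  -- that both sides are functions on `NNReal`.
  have hle : cfc (fun t : NNReal => c * t) M ≤ cfc (fun t : NNReal => t ^ s + d) M := by
    refine cfc_mono (fun t _ => ?_) (by fun_prop) (by fun_prop)
    rw [← NNReal.coe_le_coe]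
    push_cast
    rw [hc, hd]
    exact mul_rpow_sub_one_le hs a.2 t.2
  rw [cfc_const_mul_id c M hM, cfc_add_const d _ M (by fun_prop) hM, ← CFC.rpow_def] at hle
  have h := re_inner_mono hle x
  have e1 : RCLike.re ⟪x, (c • M) x⟫_ℂ = c * a := by
    rw [ha, NNReal.smul_def, smul_apply, inner_smul_right_eq_smul, RCLike.smul_re]
  have e2 : RCLike.re ⟪x, (M ^ s + algebraMap NNReal (H →L[ℂ] H) d) x⟫_ℂ =
      RCLike.re ⟪x, (M ^ s) x⟫_ℂ + d * ‖x‖ ^ 2 := by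
    rw [add_apply, inner_add_right, map_add, Algebra.algebraMap_eq_smul_one, NNReal.smul_def,
      smul_apply, inner_smul_right_eq_smul, RCLike.smul_re, one_apply_eq_self,
      inner_self_eq_norm_sq]
  rw [e1, e2, hc] at h
  -- Since `d ≥ 0`, a subunit vector suffices here; this is what later allows contractions.
  have h3 : (d : ℝ) * ‖x‖ ^ 2 ≤ d := mul_le_of_le_one_right d.2 (pow_le_one₀ (norm_nonneg x) hx)
  have h4 : (a : ℝ) ^ (s - 1) * a = (a : ℝ) ^ s := by
    have h5 := Real.rpow_add_of_nonneg a.2 (sub_pos.2 hs).le zero_le_one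
    rw [sub_add_cancel, Real.rpow_one] at h5
    exact h5.symm
  rw [mul_assoc, h4] at h
  rw [← ha]
  linarith

/-! ### Finite orthonormal families and partial traces -/

/-- Expand each `√M (h j)` in a Hilbert basis, exchange the sums, and apply Bessel's inequality to
`√M (b i)`. -/
theorem sum_ofReal_re_inner_le_opTrace {ι : Type*} [Fintype ι] {h : ι → H}
    (hh : Orthonormal ℂ h) {M : H →L[ℂ] H} (hM : 0 ≤ M) :
    ∑ j, ENNReal.ofReal (RCLike.re ⟪h j, M (h j)⟫_ℂ) ≤ opTrace M := by
  obtain ⟨w, b, hb⟩ := exists_hilbertBasis ℂ H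
  rw [opTrace_eq b hM]
  simp only [re_inner_eq_norm_sqrt_sq hM]
  calc ∑ j, ENNReal.ofReal (‖CFC.sqrt M (h j)‖ ^ 2)
      = ∑ j, ∑' i, ENNReal.ofReal (‖⟪b i, CFC.sqrt M (h j)⟫_ℂ‖ ^ 2) := by
        simp_rw [ofReal_norm_sq_eq_tsum b]
    _ = ∑' i, ∑ j, ENNReal.ofReal (‖⟪b i, CFC.sqrt M (h j)⟫_ℂ‖ ^ 2) :=
        (Summable.tsum_finsetSum fun _ _ => ENNReal.summable).symm
    _ ≤ ∑' i, ENNReal.ofReal (‖CFC.sqrt M (b i)‖ ^ 2) := by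
        refine ENNReal.tsum_le_tsum fun i => ?_
        rw [← ENNReal.ofReal_sum_of_nonneg fun _ _ => by positivity]
        refine ENNReal.ofReal_le_ofReal ?_
        refine le_trans (le_of_eq ?_) (hh.sum_inner_products_le (s := Finset.univ) _)
        refine Finset.sum_congr rfl fun j _ => ?_
        rw [inner_apply_comm (CFC.sqrt_nonneg M), ← inner_conj_symm, RCLike.norm_conj]

omit [CompleteSpace H] in
-- The spectral theorem for the compression of `N` to the span of the `b k`. Both sums are the trace
-- of the compression of `Z`, so they agree for every `Z`.
theorem exists_orthonormal_diagonalizing {ι : Type*} {b : ι → H} (hb : Orthonormal ℂ b)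
    (F : Finset ι) {N : H →L[ℂ] H} (hN : 0 ≤ N) :
    ∃ (m : ℕ) (f : Fin m → H), Orthonormal ℂ f ∧ (∀ i j, i ≠ j → ⟪f i, N (f j)⟫_ℂ = 0) ∧
      ∀ Z : H →L[ℂ] H, ∑ k ∈ F, RCLike.re ⟪b k, Z (b k)⟫_ℂ = ∑ j, RCLike.re ⟪f j, Z (f j)⟫_ℂ := by
  classical
  let V : Submodule ℂ H := Submodule.span ℂ (F.image b : Set H)
  let e : OrthonormalBasis F ℂ V := OrthonormalBasis.span hb F
  have he : ∀ k : F, (e k : H) = b k := OrthonormalBasis.span_apply hb F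
  let C : (H →L[ℂ] H) → V →ₗ[ℂ] V := fun Z =>
    (V.orthogonalProjectionOnto.toLinearMap ∘ₗ Z.toLinearMap) ∘ₗ V.subtype
  have hC : ∀ Z, ∀ v w : V, ⟪v, C Z w⟫_ℂ = ⟪(v : H), Z w⟫_ℂ := fun Z v w =>
    Submodule.inner_orthogonalProjectionOnto_eq_of_mem_left v (Z w)
  have hs : (C N).IsSymmetric := fun v w => by
    rw [hC, ← inner_conj_symm, hC, inner_apply_comm hN, inner_conj_symm]
  let f := hs.eigenvectorBasis rfl
  refine ⟨_, fun j => (f j : H), f.orthonormal.comp_linearIsometry V.subtypeₗᵢ, ?_, ?_⟩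
  · intro i j hij
    rw [← hC, hs.apply_eigenvectorBasis, inner_smul_right, f.inner_eq_zero hij, mul_zero]
  · intro Z
    have h1 := (LinearMap.trace_eq_sum_inner (C Z) e).symm.trans
      (LinearMap.trace_eq_sum_inner (C Z) f)
    simp only [hC, he] at h1
    rw [← Finset.sum_coe_sort F, ← map_sum, ← map_sum, h1]

/-! ### The one-shot inequalities for a test -/

theorem conj_nonneg {A B : H →L[ℂ] H} (hA : 0 ≤ A) (hB : 0 ≤ B) : 0 ≤ A * B * A :=
  (IsSelfAdjoint.of_nonneg hA).conjugate_nonneg hB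

omit [CompleteSpace H] in
theorem inner_conj_apply {A : H →L[ℂ] H} (hA : 0 ≤ A) (B : H →L[ℂ] H) (x y : H) :
    ⟪x, (A * B * A) y⟫_ℂ = ⟪A x, B (A y)⟫_ℂ :=
  inner_apply_comm hA x _

/-- Hölder's inequality combined with the Araki–Lieb–Thirring inequality for a contraction. -/
theorem opTrace_conj_le {α p : ℝ} (hαp : α.HolderConjugate p) {S R A σ : H →L[ℂ] H}
    (hS : 0 ≤ S) (hR : 0 ≤ R) (hA : 0 ≤ A) (hσ : 0 ≤ σ) (hA1 : ∀ x, ‖A x‖ ≤ ‖x‖)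
    (hSσ : (S * S) ^ p = σ) :
    opTrace (A * (S * R * S) * A) ≤
      opTrace (R ^ α) ^ (1 / α) * opTrace (A * σ * A) ^ (1 / p) := by
  classical
  obtain ⟨w, b, hb⟩ := exists_hilbertBasis ℂ H
  have hSS : 0 ≤ S * S := (IsSelfAdjoint.of_nonneg hS).mul_self_nonneg
  have hZ := conj_nonneg hA (conj_nonneg hS hR)
  rw [opTrace_eq b hZ, ENNReal.tsum_eq_iSup_sum]
  refine iSup_le fun F => ?_
  rw [← ENNReal.ofReal_sum_of_nonneg fun _ _ => re_inner_nonneg hZ _]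
  obtain ⟨m, f, hf, hdiag, htr⟩ :=
    exists_orthonormal_diagonalizing b.orthonormal F (conj_nonneg hA hSS)
  rw [htr]
  -- The Gram matrix of `g` is the diagonalized compression of `A S² A`, so the nonzero `g j`
  -- normalize to an orthonormal family `h`.
  set g : Fin m → H := fun j => S (A (f j)) with hg
  have hgg : ∀ i j, ⟪g i, g j⟫_ℂ = ⟪f i, (A * (S * S) * A) (f j)⟫_ℂ := fun i j => by
    rw [inner_conj_apply hA, mul_apply_eq_comp]
    exact (inner_apply_comm hS _ _).symm
  let h : {j // g j ≠ 0} → H := fun j => ((‖g j‖⁻¹ : ℝ) : ℂ) • g j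
  have hh1 : ∀ j, ‖h j‖ = 1 := fun j => by
    simp only [h, norm_smul, Complex.norm_real, norm_inv, norm_norm]
    exact inv_mul_cancel₀ (norm_ne_zero_iff.2 j.2)
  have hh : Orthonormal ℂ h := by
    refine ⟨hh1, fun i j hij => ?_⟩
    change ⟪h i, h j⟫_ℂ = 0
    rw [inner_smul_left, inner_smul_right, hgg, hdiag _ _ (fun e => hij (Subtype.ext e)),
      mul_zero, mul_zero]
  have hsum : ∑ j, RCLike.re ⟪f j, (A * (S * R * S) * A) (f j)⟫_ℂ =
      ∑ j : {j // g j ≠ 0}, RCLike.re ⟪h j, R (h j)⟫_ℂ * ‖g j‖ ^ 2 := by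
    have e1 : ∀ j, RCLike.re ⟪f j, (A * (S * R * S) * A) (f j)⟫_ℂ = RCLike.re ⟪g j, R (g j)⟫_ℂ :=
      fun j => by rw [inner_conj_apply hA, inner_conj_apply hS]
    have e2 : ∀ j : {j // g j ≠ 0},
        RCLike.re ⟪h j, R (h j)⟫_ℂ * ‖g j‖ ^ 2 = RCLike.re ⟪g j, R (g j)⟫_ℂ := fun j => by
      have hj : ‖g j‖ ≠ 0 := norm_ne_zero_iff.2 j.2
      simp only [h, map_smul, inner_smul_left, inner_smul_right, Complex.conj_ofReal]
      rw [← mul_assoc, ← Complex.ofReal_mul, RCLike.re_to_complex, RCLike.re_to_complex,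
        Complex.re_ofReal_mul]
      field_simp
    simp_rw [e1, e2]
    rw [← Finset.sum_subtype (Finset.univ.filter fun j => g j ≠ 0) (by simp)
      fun j => RCLike.re ⟪g j, R (g j)⟫_ℂ]
    symm
    apply Finset.sum_filter_of_ne
    intro j _ hne h0
    rw [h0, inner_zero_left, map_zero] at hne
    exact hne rfl
  rw [hsum, ENNReal.ofReal_sum_of_nonneg
    fun _ _ => mul_nonneg (re_inner_nonneg hR _) (by positivity)]
  simp_rw [ENNReal.ofReal_mul (re_inner_nonneg hR _)]
  refine (ENNReal.inner_le_Lp_mul_Lq _ _ _ hαp).trans (mul_le_mul' ?_ ?_)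
  · refine ENNReal.rpow_le_rpow (le_trans (Finset.sum_le_sum fun j _ => ?_)
      (sum_ofReal_re_inner_le_opTrace hh CFC.rpow_nonneg)) (one_div_nonneg.2 hαp.nonneg)
    rw [ENNReal.ofReal_rpow_of_nonneg (re_inner_nonneg hR _) hαp.nonneg]
    exact ENNReal.ofReal_le_ofReal (re_inner_rpow_le hR hαp.lt (hh1 j).le)
  · refine ENNReal.rpow_le_rpow (le_trans (Finset.sum_le_sum fun j _ => ?_)
      (sum_ofReal_re_inner_le_opTrace (hf.comp _ Subtype.val_injective) (conj_nonneg hA hσ)))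
      (one_div_nonneg.2 hαp.symm.nonneg)
    rw [ENNReal.ofReal_rpow_of_nonneg (by positivity) hαp.symm.nonneg]
    refine ENNReal.ofReal_le_ofReal ?_
    -- `‖g j‖ ^ 2 = ⟪A f j, S² A f j⟫`, and Jensen at the subunit vector `A f j` moves the power `p`
    -- onto `S²`, turning it into `σ`.
    have hx : ‖A (f j)‖ ≤ 1 := (hA1 _).trans (hf.1 j).le
    have h1 := re_inner_rpow_le hSS hαp.symm.lt hx
    rw [hSσ, mul_apply_eq_comp, inner_apply_comm hS, inner_self_eq_norm_sq] at h1
    rw [Function.comp_apply, inner_conj_apply hA]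
    exact h1

theorem rpow_mul_self_rpow {σ : H →L[ℂ] H} (hσ : 0 ≤ σ) {t p : ℝ} (ht : 0 ≤ t) (hp : 0 ≤ p)
    (htp : t * 2 * p = 1) : (σ ^ t * σ ^ t) ^ p = σ := by
  have h2 : σ ^ t * σ ^ t = σ ^ (t * 2) := by
    rw [← pow_two, ← CFC.rpow_natCast _ 2 CFC.rpow_nonneg,
      CFC.rpow_rpow_of_exponent_nonneg σ _ _ ht (Nat.cast_nonneg 2) hσ, Nat.cast_ofNat]
  rw [h2, CFC.rpow_rpow_of_exponent_nonneg σ _ _ (by positivity) hp hσ, htp, CFC.rpow_one σ hσ]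

theorem IsRenyiFactor.testTrace_le {α : ℝ} (hα : 1 < α) {T ρ σ R : H →L[ℂ] H} (hT : IsTest T)
    (hρ : 0 ≤ ρ) (hσ : 0 ≤ σ) (hR : IsRenyiFactor α α ρ σ R) :
    testTrace T ρ ≤ opTrace (R ^ α) ^ α⁻¹ * testTrace T σ ^ (1 - α⁻¹) := by
  have hα0 : 0 < α := by linarith
  have hα1 : 0 < α - 1 := by linarith
  have hαp : α.HolderConjugate (α / (α - 1)) := Real.HolderConjugate.conjExponent hα
  have hρeq := hR.eq
  rw [div_self hα0.ne', CFC.rpow_one ρ hρ] at hρeq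
  -- The conjugate exponent `p = α / (α - 1)` is exactly the one that recovers `σ` from the two
  -- outer factors.
  have ht : (α - 1) / (2 * α) * 2 * (α / (α - 1)) = 1 := by field_simp
  have h := opTrace_conj_le hαp (S := σ ^ ((α - 1) / (2 * α))) CFC.rpow_nonneg hR.nonneg
    (CFC.sqrt_nonneg T) hσ (norm_sqrt_apply_le hT)
    (rpow_mul_self_rpow hσ (by positivity) (by positivity) ht)
  have e : 1 / (α / (α - 1)) = 1 - α⁻¹ := by field_simp
  rw [← hρeq, e, one_div] at h
  exact h

theorem testTrace_le_of_memB {α : ℝ} (hα : 1 < α) {T ρ σ : H →L[ℂ] H} (hT : IsTest T)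
    (hρ : 0 ≤ ρ) (hσ : 0 ≤ σ) (hB : MemB α α ρ σ) :
    testTrace T ρ ≤ renyiQ α α ρ σ ^ α⁻¹ * testTrace T σ ^ (1 - α⁻¹) := by
  rw [renyiQ, if_pos hB]
  exact (isRenyiFactor_renyiFactor hα (by linarith) hσ hB).testTrace_le hα hT hρ hσ

/-- `√ρ √T` and its adjoint `√T √ρ` have the same Hilbert–Schmidt norm, and `√T` is a contraction.
-/
theorem testTrace_le_opTrace {T ρ : H →L[ℂ] H} (hT : IsTest T) (hρ : 0 ≤ ρ) :
    testTrace T ρ ≤ opTrace ρ := by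
  obtain ⟨w, b, hb⟩ := exists_hilbertBasis ℂ H
  rw [testTrace, opTrace_eq b (conj_nonneg (CFC.sqrt_nonneg T) hρ), opTrace_eq b hρ]
  simp only [inner_conj_apply (CFC.sqrt_nonneg T), re_inner_eq_norm_sqrt_sq hρ]
  calc ∑' i, ENNReal.ofReal (‖CFC.sqrt ρ (CFC.sqrt T (b i))‖ ^ 2)
      = ∑' i, ∑' j, ENNReal.ofReal (‖⟪b j, CFC.sqrt ρ (CFC.sqrt T (b i))⟫_ℂ‖ ^ 2) := by
        simp_rw [ofReal_norm_sq_eq_tsum b]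
    _ = ∑' j, ∑' i, ENNReal.ofReal (‖⟪b j, CFC.sqrt ρ (CFC.sqrt T (b i))⟫_ℂ‖ ^ 2) :=
        ENNReal.tsum_comm
    _ = ∑' j, ENNReal.ofReal (‖CFC.sqrt T (CFC.sqrt ρ (b j))‖ ^ 2) := by
        refine tsum_congr fun j => ?_
        rw [ofReal_norm_sq_eq_tsum b]
        refine tsum_congr fun i => ?_
        rw [inner_apply_comm (CFC.sqrt_nonneg ρ), inner_apply_comm (CFC.sqrt_nonneg T),
          ← inner_conj_symm, RCLike.norm_conj]
    _ ≤ ∑' j, ENNReal.ofReal (‖CFC.sqrt ρ (b j)‖ ^ 2) :=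
        ENNReal.tsum_le_tsum fun j => ENNReal.ofReal_le_ofReal
          (pow_le_pow_left₀ (norm_nonneg _) (norm_sqrt_apply_le hT _) 2)

theorem testTrace_le_exp_mul {T ρ σ : H →L[ℂ] H} {κ : ℝ} (h : ρ ≤ Real.exp κ • σ) :
    testTrace T ρ ≤ ENNReal.ofReal (Real.exp κ) * testTrace T σ := by
  rw [testTrace, testTrace, opTrace, opTrace, ← ENNReal.tsum_mul_left]
  refine ENNReal.tsum_le_tsum fun i => ?_
  rw [← ENNReal.ofReal_mul (Real.exp_pos κ).le, inner_conj_apply (CFC.sqrt_nonneg T),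
    inner_conj_apply (CFC.sqrt_nonneg T)]
  refine ENNReal.ofReal_le_ofReal ((re_inner_mono h _).trans_eq ?_)
  rw [smul_apply, inner_smul_right_eq_smul, RCLike.smul_re]

/-- The three regimes of `u` in one form. Real bounds `x` and `y` avoid `∞ - ∞`; strictness in `hx`
yields an admissible `κ` at `u = 1` and excludes `Q = ∞` for `0 < u < 1`. -/
theorem log_testTrace_le {T ρ σ : H →L[ℂ] H} (hT : IsTest T) (hρ : 0 ≤ ρ) (hσ : 0 ≤ σ)
    {u : ℝ} (hu : u ∈ Set.Icc (0 : ℝ) 1) {x y : ℝ} (hx : psiTilde ρ σ u < x)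
    (hy : ENNReal.log (testTrace T σ) ≤ y) :
    ENNReal.log (testTrace T ρ) ≤ ((x + u * y : ℝ) : EReal) := by
  rcases hu.1.eq_or_lt with rfl | hu0
  · rw [psiTilde, if_pos rfl] at hx
    rw [zero_mul, add_zero]
    exact (ENNReal.log_le_log (testTrace_le_opTrace hT hρ)).trans hx.le
  rcases hu.2.eq_or_lt with rfl | hu1
  · rw [psiTilde, if_neg one_ne_zero, if_pos rfl, Dmax] at hx
    simp only [iInf_lt_iff] at hx
    obtain ⟨κ, hκ, hκx⟩ := hx
    have h := ENNReal.log_le_log (testTrace_le_exp_mul (T := T) hκ)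
    rw [ENNReal.log_mul_add, ENNReal.log_ofReal_of_pos (Real.exp_pos κ), Real.log_exp] at h
    rw [one_mul, EReal.coe_add]
    exact h.trans (add_le_add hκx.le hy)
  · have h1u : 0 < 1 - u := sub_pos.2 hu1
    rw [psiTilde, if_neg hu0.ne', if_neg hu1.ne] at hx
    have hα : 1 < (1 - u)⁻¹ := (one_lt_inv₀ h1u).2 (by linarith)
    have hB : MemB (1 - u)⁻¹ (1 - u)⁻¹ ρ σ := by
      by_contra hB
      rw [psiStar, renyiQ, if_neg hB, ENNReal.log_top, EReal.coe_mul_top_of_pos h1u] at hx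
      exact not_top_lt hx
    have h := ENNReal.log_le_log (testTrace_le_of_memB hα hT hρ hσ hB)
    rw [ENNReal.log_mul_add, ENNReal.log_rpow, ENNReal.log_rpow, inv_inv, sub_sub_cancel] at h
    rw [EReal.coe_add, EReal.coe_mul]
    exact h.trans (add_le_add hx.le (mul_le_mul_of_nonneg_left hy (EReal.coe_nonneg.2 hu0.le)))

end SingleSpace

/-! ### Passage to the limit -/

section Sequences

variable {H : ℕ → Type*} [∀ n, NormedAddCommGroup (H n)] [∀ n, InnerProductSpace ℂ (H n)]
  [∀ n, CompleteSpace (H n)]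

theorem sub_psiTildeSeq_le_liminf_rate {ρ σ T : ∀ n, H n →L[ℂ] H n} (hρ : ∀ n, 0 ≤ ρ n)
    (hσ : ∀ n, 0 ≤ σ n) {r u : ℝ} (hT : IsAdmissible σ r T) (hu : u ∈ Set.Icc (0 : ℝ) 1) :
    ((u * r : ℝ) : EReal) - psiTildeSeq ρ σ u ≤ Filter.liminf (rate T ρ) Filter.atTop := by
  refine EReal.ge_of_forall_gt_iff_ge.1 fun c hc => ?_
  have hψ : psiTildeSeq ρ σ u < ((u * r - c : ℝ) : EReal) := by
    rw [EReal.coe_sub]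
    induction h : psiTildeSeq ρ σ u with
    | bot => exact EReal.bot_lt_coe _
    | top => simp [h] at hc
    | coe d => rw [h] at hc; norm_cast at hc ⊢; linarith
  obtain ⟨d, hd1, hd2⟩ := EReal.lt_iff_exists_real_btwn.1 hψ
  -- With the gap `ε = u * r - c - d > 0`, take `s = r - ε`; as `u ≤ 1`, lowering `r` by `ε` costs
  -- at most `ε`.
  obtain ⟨s, hs1, hs2⟩ : ∃ s : ℝ, s < r ∧ c ≤ u * s - d := by
    have hd3 : d < u * r - c := EReal.coe_lt_coe_iff.1 hd2
    refine ⟨r - (u * r - c - d), by linarith, ?_⟩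
    nlinarith [hu.2]
  have hev1 := Filter.eventually_lt_of_limsup_lt hd1
  have hev2 := Filter.eventually_lt_of_lt_liminf
    ((EReal.coe_lt_coe_iff.2 hs1).trans_le hT.2)
  refine Filter.le_liminf_of_le (by isBoundedDefault) ?_
  -- The index `n = 0` is excluded because there `1 / n` is `0` and the rescaling fails.
  filter_upwards [hev1, hev2, Filter.eventually_gt_atTop 0] with n h1 h2 hn
  have hn0 : (0 : ℝ) < n := Nat.cast_pos.2 hn
  have hinv : (0 : ℝ) < 1 / n := one_div_pos.2 hn0
  have scale : ∀ (z : EReal) (t : ℝ), ((1 / (n : ℝ) : ℝ) : EReal) * z < t →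
      z < ((n * t : ℝ) : EReal) := by
    intro z t hz
    induction z with
    | bot => exact EReal.bot_lt_coe _
    | top => rw [EReal.coe_mul_top_of_pos hinv] at hz; exact absurd hz not_top_lt
    | coe z =>
      norm_cast at hz ⊢
      rw [one_div_mul_eq_div, div_lt_iff₀ hn0] at hz
      linarith
  have hx := scale _ _ h1
  have hy := scale (ENNReal.log (testTrace (T n) (σ n))) (-s) (by
    rw [EReal.coe_neg]; exact EReal.lt_neg_comm.1 h2)
  have h := log_testTrace_le (hT.1 n) (hρ n) (hσ n) hu hx hy.le
  have h' := mul_le_mul_of_nonneg_left h (EReal.coe_nonneg.2 hinv.le)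
  rw [rate, EReal.le_neg, ← EReal.coe_neg]
  refine h'.trans ?_
  rw [← EReal.coe_mul, EReal.coe_le_coe_iff]
  have : 1 / (n : ℝ) * (n * d + u * (n * -s)) = d - u * s := by field_simp; ring
  rw [this]
  linarith

theorem hoeffdingAnti_le_scLower {ρ σ : ∀ n, H n →L[ℂ] H n} (hρ : ∀ n, 0 ≤ ρ n)
    (hσ : ∀ n, 0 ≤ σ n) (r : ℝ) : hoeffdingAnti ρ σ r ≤ scLower ρ σ r := by
  refine iSup₂_le fun u hu => le_sInf ?_
  rintro _ ⟨T, hT, rfl⟩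
  exact sub_psiTildeSeq_le_liminf_rate hρ hσ hT hu

theorem scLower_le_scUpper (ρ σ : ∀ n, H n →L[ℂ] H n) (r : ℝ) :
    scLower ρ σ r ≤ scUpper ρ σ r := by
  refine le_sInf ?_
  rintro _ ⟨T, hT, rfl⟩
  have h : scLower ρ σ r ≤ Filter.liminf (rate T ρ) Filter.atTop := sInf_le ⟨T, hT, rfl⟩
  exact h.trans Filter.liminf_le_limsup

theorem scUpper_le_sc (ρ σ : ∀ n, H n →L[ℂ] H n) (r : ℝ) : scUpper ρ σ r ≤ sc ρ σ r := by
  refine le_sInf ?_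
  rintro x ⟨T, hT, hx⟩
  exact sInf_le ⟨T, hT, hx.limsup_eq.symm⟩

end Sequences

end OpDiscr

theorem mainTheorem11 {H : ℕ → Type*} [∀ n, NormedAddCommGroup (H n)]
    [∀ n, InnerProductSpace ℂ (H n)] [∀ n, CompleteSpace (H n)]
    [∀ n, TopologicalSpace.SeparableSpace (H n)]
    (ρ σ : ∀ n, H n →L[ℂ] H n)
    (hρ : ∀ n, 0 ≤ ρ n) (hρ0 : ∀ n, ρ n ≠ 0) (hσ : ∀ n, 0 ≤ σ n) (hσ0 : ∀ n, σ n ≠ 0)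
    (r : ℝ) :
    OpDiscr.hoeffdingAnti ρ σ r ≤ OpDiscr.scLower ρ σ r ∧
      OpDiscr.scLower ρ σ r ≤ OpDiscr.scUpper ρ σ r ∧
      OpDiscr.scUpper ρ σ r ≤ OpDiscr.sc ρ σ r :=
  ⟨OpDiscr.hoeffdingAnti_le_scLower hρ hσ r, OpDiscr.scLower_le_scUpper ρ σ r,
    OpDiscr.scUpper_le_sc ρ σ r⟩
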